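/- Consider $n$ players and a single processor that can run at variable speed, where $\alpha\in[2,3]$ is a fixed constant. Player $i$ has a job with workload $w_i\ge 0$, release time $r_i$ and deadline $d_i>r_i$. A (preemptive) schedule chooses at each time $t$ a speed $s(t)\ge 0$ and at most one job to run; when no job is run, the processor is idle and $s(t)=0$. A schedule is feasible if each job $i$ is run only during $[r_i,d_i)$ and the integral of $s$ over the times when $i$ is run equals $w_i$. The energy of a schedule $S$ is $E(S)=\int s(t)^\alpha\,\mathrm{d}t$. Let $\mathrm{OPT}(d)$ be a feasible schedule of minimum energy, and $\mathrm{OPT}(d_{-i})$ one for the instance in which job $i$ is removed. The marginal cost share of player $i$ is $b_i=E(\mathrm{OPT}(d))-E(\mathrm{OPT}(d_{-i}))$; the proportional cost share $c_i$ of player $i$ is the energy that $\mathrm{OPT}(d)$ consumes while it runs job $i$, i.e. the integral of $s^\alpha$ over the times when $i$ is run. Then a schedule $\mathrm{OPT}(d)$ exists, its energy is finite, and, whichever minimum energy schedule is chosen, every player $i$ satisfies $$c_i\;\le\; b_i\;\le\;\alpha\, c_i .$$ Consequently the marginal cost sharing scheme is $\alpha$-budget-balanced: $$E(\mathrm{OPT}(d))\;\le\;\sum_{i=1}^n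 b_i\;\le\;\alpha\,E(\mathrm{OPT}(d)).$$ The factor $\alpha$ is tight: for the instance of $n\ge1$ players with $w_i=1/n$, $r_i=0$, $d_i=1$ for all $i$, one has $E(\mathrm{OPT}(d))=1$ and $b_i=1-(1-1/n)^\alpha$ for every $i$, and $\sum_{i} b_i/E(\mathrm{OPT}(d))\to\alpha$ as $n\to\infty$. -/

import Mathlib

open MeasureTheory
open scoped NNReal ENNReal

namespace SpeedScaling

/-- A set of jobs, one for each player in `ι`: workloads, release times and the deadlines
chosen by the players. -/
structure Jobs (ι : Type) where
  workload : ι → ℝ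
  release : ι → ℝ
  deadline : ι → ℝ
  workload_nonneg : ∀ i, 0 ≤ workload i
  release_lt_deadline : ∀ i, release i < deadline i

/-- A preemptive schedule on a single variable-speed machine: at every time `t` the machine runs
at speed `speed t ≥ 0` and processes at most one job (`job t = some i`), or is idle
(`job t = none`, with speed `0`). -/
structure Schedule (ι : Type) where
  speed : ℝ → ℝ≥0
  job : ℝ → Option ι
  measurable_speed : Measurable speed
  measurableSet_job : ∀ i, MeasurableSet {t | job t = some i}
  speed_idle : ∀ t, job t = none → speed t = 0

namespace Schedule

variable {ι : Type}

/-- The amount of work of job `i` executed by the schedule. -/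
noncomputable def work (S : Schedule ι) (i : ι) : ℝ≥0∞ :=
  ∫⁻ t in {t | S.job t = some i}, (S.speed t : ℝ≥0∞)

/-- The energy `∫ s(t)^α dt` consumed by the schedule. -/
noncomputable def energy (α : ℝ) (S : Schedule ι) : ℝ≥0∞ :=
  ∫⁻ t, (S.speed t : ℝ≥0∞) ^ α

/-- The energy consumed by the schedule during the execution of job `i`. -/
noncomputable def jobEnergy (α : ℝ) (S : Schedule ι) (i : ι) : ℝ≥0∞ :=
  ∫⁻ t in {t | S.job t = some i}, (S.speed t : ℝ≥0∞) ^ α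

end Schedule

namespace Jobs

variable {ι : Type}

/-- A schedule is feasible if every job is executed only between its release time and its
deadline, and is completely executed. -/
structure IsFeasible (J : Jobs ι) (S : Schedule ι) : Prop where
  window : ∀ t i, S.job t = some i → J.release i ≤ t ∧ t < J.deadline i
  complete : ∀ i, S.work i = ENNReal.ofReal (J.workload i)

/-- Minimum energy schedules, i.e. the possible choices of `OPT(d)`. -/
structure IsOptimal (α : ℝ) (J : Jobs ι) (S : Schedule ι) : Prop where
  feasible : J.IsFeasible S
  energy_le : ∀ S' : Schedule ι, J.IsFeasible S' → S.energy α ≤ S'.energy α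

/-- The optimal energy `E(OPT(d))`. -/
noncomputable def optEnergy (α : ℝ) (J : Jobs ι) : ℝ≥0∞ :=
  ⨅ (S : Schedule ι) (_ : J.IsFeasible S), S.energy α

/-- The set of jobs with job `i` removed. -/
def remove (J : Jobs ι) (i : ι) : Jobs {j : ι // j ≠ i} where
  workload j := J.workload j
  release j := J.release j
  deadline j := J.deadline j
  workload_nonneg j := J.workload_nonneg j
  release_lt_deadline j := J.release_lt_deadline j

/-- The marginal cost share `E(OPT(d)) - E(OPT(d_{-i}))` of player `i`, a real number. -/
noncomputable def marginalShare (α : ℝ) (J : Jobs ι) (i : ι) : ℝ :=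
  (J.optEnergy α).toReal - ((J.remove i).optEnergy α).toReal

end Jobs

/-- The jobs of `n` players, all with workload `1/n`, release time `0` and deadline `1`. -/
noncomputable def uniformJobs (n : ℕ) : Jobs (Fin n) where
  workload _ := 1 / (n : ℝ)
  release _ := 0
  deadline _ := 1
  workload_nonneg _ := by positivity
  release_lt_deadline _ := one_pos

end SpeedScaling

/-! The problem is relaxed: jobs may run simultaneously, at speeds that add up. Averaging such a
fractional schedule over the cells, on which the set of available jobs is constant, gives a speed
table of no larger energy, by Jensen (`IsFractional.exists_isTable`). Running the jobs of each cell
one after the other at their total speed turns a table into a schedule of the same energy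
(`IsTable.exists_isFeasible`). Hence the relaxation has the same optimal energy, and since tables
form a compact set, the optimum is attained.

For `c_i ≤ b_i`, erase job `i` from the optimal schedule. For `b_i ≤ α c_i`, speed up job `i` by `1
+ ε` in the optimal schedule and mix the result with an optimal schedule of the other jobs, with
weights `1/(1+ε)` and `ε/(1+ε)`. The mixture does the right amount of every job, so convexity of the
power gives `ε b_i ≤ ((1+ε)^α - 1) c_i`; divide by `ε` and let `ε → 0`. Budget balance follows
because the `c_i` add up to the optimal energy. Tightness is the derivative of `x ^ α` at `1`. -/

namespace SpeedScaling

/-! ### Subsets of prescribed measure, and Jensen's inequality -/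

/-- A measurable set of reals of finite measure has measurable subsets of every smaller measure. -/
theorem exists_measurableSet_subset_volume_eq {C : Set ℝ} (hC : MeasurableSet C)
    (hfin : volume C ≠ ⊤) {m : ℝ≥0∞} (hm : m ≤ volume C) :
    ∃ D ⊆ C, MeasurableSet D ∧ volume D = m := by
  rcases eq_or_ne m 0 with rfl | hm0
  · exact ⟨∅, Set.empty_subset _, MeasurableSet.empty, measure_empty⟩
  rcases eq_or_lt_of_le hm with rfl | hlt
  · exact ⟨C, subset_rfl, hC, rfl⟩
  have : IsFiniteMeasure (volume.restrict C) := ⟨by simpa using hfin.lt_top⟩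
  have hmtop : m ≠ ⊤ := ne_top_of_lt hlt
  -- The part of `C` to the left of `x` has a measure that is 1-Lipschitz in `x` and runs from `0`
  -- to `volume C`, so the intermediate value theorem applies.
  set g : ℝ → ℝ := fun x ↦ (volume.restrict C).real (Set.Iic x) with hg
  have hgc : Continuous g := by
    refine (LipschitzWith.of_le_add (f := g) fun x y ↦ ?_).continuous
    have hsub : Set.Iic x ⊆ Set.Iic y ∪ Set.Ioc y x := fun z hz ↦ by
      rcases le_or_gt z y with h | h
      · exact Or.inl h
      · exact Or.inr ⟨h, hz⟩
    calc g x ≤ (volume.restrict C).real (Set.Iic y ∪ Set.Ioc y x) := measureReal_mono hsub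
      _ ≤ g y + (volume.restrict C).real (Set.Ioc y x) := measureReal_union_le _ _
      _ ≤ g y + dist x y := by
        gcongr
        refine ENNReal.toReal_le_of_le_ofReal dist_nonneg ?_
        refine (Measure.restrict_apply_le _ _).trans ?_
        rw [Real.volume_Ioc]
        exact ENNReal.ofReal_le_ofReal (le_abs_self _)
  have htop : Filter.Tendsto (fun x : ℝ ↦ volume.restrict C (Set.Iic x)) Filter.atTop
      (nhds (volume C)) := by
    simpa using tendsto_measure_Iic_atTop (volume.restrict C)
  have hbot : Filter.Tendsto (fun x : ℝ ↦ volume.restrict C (Set.Iic x)) Filter.atBot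
      (nhds 0) := by
    have h := tendsto_measure_iInter_atBot (μ := volume.restrict C) (s := fun x : ℝ ↦ Set.Iic x)
      (fun _ ↦ measurableSet_Iic.nullMeasurableSet) (fun _ _ ↦ Set.Iic_subset_Iic.2)
      ⟨0, measure_ne_top _ _⟩
    have hempty : ⋂ x : ℝ, Set.Iic x = ∅ :=
      Set.eq_empty_of_forall_notMem fun t ht ↦
        (sub_one_lt t).not_ge (Set.mem_iInter.1 ht (t - 1))
    rwa [hempty, measure_empty] at h
  obtain ⟨a, ha⟩ := (hbot.eventually (gt_mem_nhds (pos_iff_ne_zero.2 hm0))).exists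
  obtain ⟨b, hb⟩ := (htop.eventually (lt_mem_nhds hlt)).exists
  obtain ⟨x, hx⟩ := mem_range_of_exists_le_of_exists_ge hgc
    ⟨a, (ENNReal.toReal_le_toReal (measure_ne_top _ _) hmtop).2 ha.le⟩
    ⟨b, (ENNReal.toReal_le_toReal hmtop (measure_ne_top _ _)).2 hb.le⟩
  refine ⟨Set.Iic x ∩ C, Set.inter_subset_right, measurableSet_Iic.inter hC, ?_⟩
  rw [← Measure.restrict_apply measurableSet_Iic]
  exact (ENNReal.toReal_eq_toReal_iff' (measure_ne_top _ _) hmtop).1 hx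

/-- A measurable set of reals of finite measure contains disjoint measurable sets of prescribed
measures, as long as these do not add up to more than the measure of the set. -/
theorem exists_pairwiseDisjoint_volume_eq {ι : Type} (s : Finset ι) (m : ι → ℝ≥0∞) :
    ∀ {C : Set ℝ}, MeasurableSet C → volume C ≠ ⊤ → ∑ j ∈ s, m j ≤ volume C →
      ∃ D : ι → Set ℝ, (∀ j ∈ s, D j ⊆ C ∧ MeasurableSet (D j) ∧ volume (D j) = m j) ∧
        (s : Set ι).PairwiseDisjoint D := by
  classical
  induction s using Finset.induction_on with
  | empty => intro C _ _ _; exact ⟨fun _ ↦ ∅, by simp, by simp⟩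
  | insert a s ha ih =>
    intro C hC hfin hsum
    rw [Finset.sum_insert ha] at hsum
    obtain ⟨B, hBC, hB, hBm⟩ :=
      exists_measurableSet_subset_volume_eq hC hfin (le_self_add.trans hsum)
    have hBfin : volume B ≠ ⊤ := measure_ne_top_of_subset hBC hfin
    have hdiff : ∑ j ∈ s, m j ≤ volume (C \ B) := by
      rw [measure_sdiff hBC hB.nullMeasurableSet hBfin, hBm]
      exact ENNReal.le_sub_of_add_le_left (hBm ▸ hBfin) hsum
    obtain ⟨D, hD, hdisj⟩ := ih (hC.diff hB)
      (measure_ne_top_of_subset Set.sdiff_subset hfin) hdiff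
    have hne : ∀ j ∈ s, j ≠ a := fun j hj h ↦ ha (h ▸ hj)
    have hBD : ∀ j ∈ s, Disjoint B (D j) := fun j hj ↦
      Set.disjoint_sdiff_right.mono_right (hD j hj).1
    refine ⟨Function.update D a B, ?_, ?_⟩
    · intro j hj
      rcases Finset.mem_insert.1 hj with rfl | hj
      · simpa using ⟨hBC, hB, hBm⟩
      · rw [Function.update_of_ne (hne j hj)]
        exact ⟨(hD j hj).1.trans Set.sdiff_subset, (hD j hj).2⟩
    · rw [Finset.coe_insert, Set.pairwiseDisjoint_insert]
      refine ⟨fun j hj k hk hjk ↦ ?_, fun j hj _ ↦ ?_⟩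
      · simpa [Function.onFun, Function.update_of_ne (hne j hj),
          Function.update_of_ne (hne k hk)] using hdisj hj hk hjk
      · simpa [Function.update_of_ne (hne j hj)] using hBD j hj

/-- Jensen's inequality for powers, on a set of measure `m`. -/
theorem rpow_setLIntegral_le {α : ℝ} (hα : 1 ≤ α) {C : Set ℝ} {f : ℝ → ℝ≥0}
    (hf : Measurable f) :
    (∫⁻ t in C, (f t : ℝ≥0∞)) ^ α ≤
      volume C ^ (α - 1) * ∫⁻ t in C, (f t : ℝ≥0∞) ^ α := by
  have hα0 : 0 < α := one_pos.trans_le hα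
  have h := eLpNorm'_le_eLpNorm'_mul_rpow_measure_univ (μ := volume.restrict C) one_pos hα
    (f := fun t ↦ (f t : ℝ)) hf.coe_nnreal_real.aestronglyMeasurable
  have he : ∀ t, ‖(f t : ℝ)‖ₑ = (f t : ℝ≥0∞) := fun t ↦ by simp [enorm_eq_nnnorm]
  simp only [eLpNorm', he, ENNReal.rpow_one, div_one, Measure.restrict_apply_univ] at h
  refine (ENNReal.rpow_le_rpow h hα0.le).trans_eq ?_
  rw [ENNReal.mul_rpow_of_nonneg _ _ hα0.le, ← ENNReal.rpow_mul, ← ENNReal.rpow_mul,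
    one_div_mul_cancel hα0.ne', ENNReal.rpow_one, mul_comm]
  congr 2
  field_simp

variable {ι : Type}

/-! ### Cells, fractional schedules and speed tables -/

namespace Jobs

/-- The jobs that may be executed at time `t`. -/
def available (J : Jobs ι) (t : ℝ) : Set ι :=
  {j | J.release j ≤ t ∧ t < J.deadline j}

/-- The set of times at which exactly the jobs in `A` may be executed. -/
def cell (J : Jobs ι) (A : Set ι) : Set ℝ := J.available ⁻¹' {A}

/-- The length of a cell, and `0` for the unbounded cell in which no job may be executed. -/
noncomputable def cellLength (J : Jobs ι) (A : Set ι) : ℝ≥0 := (volume (J.cell A)).toNNReal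

/-- A fractional schedule runs the jobs simultaneously, job `j` at speed `y j t`. -/
structure IsFractional (J : Jobs ι) (y : ι → ℝ → ℝ≥0) : Prop where
  measurable : ∀ j, Measurable (y j)
  support : ∀ j t, j ∉ J.available t → y j t = 0
  complete : ∀ j, ∫⁻ t, (y j t : ℝ≥0∞) = ENNReal.ofReal (J.workload j)

/-- A speed table is a fractional schedule with constant speeds on every cell. -/
structure IsTable [Fintype ι] (J : Jobs ι) (x : ι → Set ι → ℝ≥0) : Prop where
  support : ∀ j A, j ∉ A → x j A = 0
  -- Speeds on cells of length `0` do not enter `complete`; left free for `j ∈ A`, they would spoil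
  -- compactness.
  null : ∀ j A, J.cellLength A = 0 → x j A = 0
  complete : ∀ j, ∑ A, J.cellLength A * x j A = (J.workload j).toNNReal

/-- The energy of a speed table. -/
noncomputable def tableEnergy [Fintype ι] (α : ℝ) (J : Jobs ι) (x : ι → Set ι → ℝ≥0) : ℝ≥0 :=
  ∑ A, J.cellLength A * (∑ j, x j A) ^ α

theorem measurable_available [Finite ι] (J : Jobs ι) : Measurable J.available :=
  measurable_set_iff.2 fun _ ↦ measurableSet_setOfPred.1 (measurableSet_Ico (α := ℝ))

theorem measurableSet_cell [Finite ι] (J : Jobs ι) (A : Set ι) : MeasurableSet (J.cell A) :=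
  J.measurable_available (measurableSet_singleton A)

theorem pairwise_disjoint_cell (J : Jobs ι) : Pairwise (Function.onFun Disjoint J.cell) :=
  fun _ _ h ↦ Disjoint.preimage _ (Set.disjoint_singleton.2 h)

theorem volume_cell_ne_top (J : Jobs ι) {A : Set ι} {j : ι} (hj : j ∈ A) :
    volume (J.cell A) ≠ ⊤ := by
  have hfin : volume (Set.Ico (J.release j) (J.deadline j)) ≠ ⊤ := measure_Ico_lt_top.ne
  refine measure_ne_top_of_subset ?_ hfin
  intro t ht
  have h : J.available t = A := ht
  exact (h ▸ hj : j ∈ J.available t)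

theorem lintegral_eq_sum_cell [Fintype ι] (J : Jobs ι) (f : ℝ → ℝ≥0∞) :
    ∫⁻ t, f t = ∑ A, ∫⁻ t in J.cell A, f t := by
  have h : ⋃ A, J.cell A = Set.univ := Set.eq_univ_of_forall fun t ↦
    Set.mem_iUnion.2 ⟨J.available t, rfl⟩
  rw [← setLIntegral_univ, ← h, lintegral_iUnion J.measurableSet_cell J.pairwise_disjoint_cell,
    tsum_fintype]

/-- Averaging a fractional schedule over each cell does not increase the energy. -/
theorem IsFractional.exists_isTable [Fintype ι] {α : ℝ} (hα : 1 ≤ α) {J : Jobs ι}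
    {y : ι → ℝ → ℝ≥0} (hy : J.IsFractional y) :
    ∃ x, J.IsTable x ∧
      (J.tableEnergy α x : ℝ≥0∞) ≤ ∫⁻ t, ((∑ j, y j t : ℝ≥0) : ℝ≥0∞) ^ α := by
  have hα0 : 0 ≤ α := zero_le_one.trans hα
  set I : ι → Set ι → ℝ≥0 := fun j A ↦ (∫⁻ t in J.cell A, (y j t : ℝ≥0∞)).toNNReal with hI
  have hIcoe : ∀ j A, (I j A : ℝ≥0∞) = ∫⁻ t in J.cell A, (y j t : ℝ≥0∞) := fun j A ↦
    ENNReal.coe_toNNReal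
      (((setLIntegral_le_lintegral _ _).trans_eq (hy.complete j)).trans_lt
        ENNReal.ofReal_lt_top).ne
  have hI0 : ∀ j A, j ∉ A → I j A = 0 := fun j A hj ↦ by
    rw [← ENNReal.coe_eq_zero, hIcoe, setLIntegral_congr_fun (J.measurableSet_cell A)
      (g := fun _ ↦ 0), lintegral_zero]
    intro t ht
    have h : J.available t = A := ht
    simp [hy.support j t (h ▸ hj)]
  -- Division by length `0` is harmless: the cell is then null if `j ∈ A`, and job `j` does no work
  -- in it if `j ∉ A`.
  have hwork : ∀ j A, J.cellLength A * (I j A / J.cellLength A) = I j A := fun j A ↦ by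
    rcases eq_or_ne (J.cellLength A) 0 with h0 | h0
    · by_cases hj : j ∈ A
      · have hv : volume (J.cell A) = 0 :=
          ((ENNReal.toNNReal_eq_zero_iff _).1 h0).resolve_right (J.volume_cell_ne_top hj)
        have : I j A = 0 := by
          rw [← ENNReal.coe_eq_zero, hIcoe, setLIntegral_measure_zero _ _ hv]
        simp [this]
      · simp [hI0 j A hj]
    · exact mul_div_cancel₀ _ h0
  refine ⟨fun j A ↦ I j A / J.cellLength A, ⟨fun j A hj ↦ by simp [hI0 j A hj],
    fun j A h ↦ by simp [h], fun j ↦ ?_⟩, ?_⟩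
  · simp only [hwork]
    rw [← ENNReal.coe_inj, ENNReal.ofNNReal_finsetSum]
    simp only [hIcoe]
    rw [← J.lintegral_eq_sum_cell, hy.complete]
    rfl
  · rw [J.lintegral_eq_sum_cell, tableEnergy, ENNReal.ofNNReal_finsetSum]
    refine Finset.sum_le_sum fun A _ ↦ ?_
    rcases eq_or_ne (J.cellLength A) 0 with h0 | h0
    · simp [h0]
    have hvol : volume (J.cell A) = J.cellLength A :=
      (ENNReal.coe_toNNReal ((ENNReal.toNNReal_ne_zero).1 h0).2).symm
    have hsum : ∫⁻ t in J.cell A, ((∑ j, y j t : ℝ≥0) : ℝ≥0∞) = (∑ j, I j A : ℝ≥0) := by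
      simp only [ENNReal.ofNNReal_finsetSum, hIcoe]
      exact lintegral_finsetSum _ fun j _ ↦ (hy.measurable j).coe_nnreal_ennreal
    have hJ := rpow_setLIntegral_le hα (C := J.cell A) (f := fun t ↦ ∑ j, y j t)
      (Finset.measurable_fun_sum _ fun j _ ↦ hy.measurable j)
    rw [hsum, hvol] at hJ
    -- The energy on the cell may be infinite, which is a trivial case; otherwise the computation
    -- takes place in `ℝ≥0`.
    generalize ∫⁻ t in J.cell A, ((∑ j, y j t : ℝ≥0) : ℝ≥0∞) ^ α = E at hJ ⊢
    induction E with
    | top => exact le_top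
    | coe e =>
      rw [← ENNReal.coe_rpow_of_nonneg _ hα0, ← ENNReal.coe_rpow_of_nonneg _ (by linarith),
        ← ENNReal.coe_mul, ENNReal.coe_le_coe, NNReal.rpow_sub_one h0] at hJ
      rw [ENNReal.coe_le_coe, ← Finset.sum_div, NNReal.div_rpow]
      have hpos : 0 < J.cellLength A ^ α := NNReal.rpow_pos (pos_iff_ne_zero.2 h0)
      rw [mul_div_assoc', div_le_iff₀ hpos]
      calc J.cellLength A * (∑ j, I j A) ^ α
          ≤ J.cellLength A * (J.cellLength A ^ α / J.cellLength A * e) := by gcongr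
        _ = e * J.cellLength A ^ α := by field_simp

end Jobs

/-! ### Decomposing a schedule into its jobs -/

namespace Schedule

/-- The speed at which job `j` is executed. -/
noncomputable def rate (S : Schedule ι) (j : ι) : ℝ → ℝ≥0 :=
  {t | S.job t = some j}.indicator S.speed

theorem measurable_rate (S : Schedule ι) (j : ι) : Measurable (S.rate j) :=
  S.measurable_speed.indicator (S.measurableSet_job j)

theorem sum_indicator_job [Fintype ι] {M : Type*} [AddCommMonoid M] (S : Schedule ι)
    (g : ℝ → M) (hg : ∀ t, S.job t = none → g t = 0) (t : ℝ) :
    ∑ j, {t | S.job t = some j}.indicator g t = g t := by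
  classical
  rcases h : S.job t with _ | k
  · simp [h, hg t h]
  · simp [Set.indicator_apply, h]

theorem sum_rate [Fintype ι] (S : Schedule ι) (t : ℝ) : ∑ j, S.rate j t = S.speed t :=
  S.sum_indicator_job S.speed S.speed_idle t

theorem lintegral_rate (S : Schedule ι) (j : ι) : ∫⁻ t, (S.rate j t : ℝ≥0∞) = S.work j := by
  rw [work, ← lintegral_indicator (S.measurableSet_job j)]
  refine lintegral_congr fun t ↦ ?_
  by_cases h : S.job t = some j <;> simp [rate, h]

theorem lintegral_speed_eq_sum_work [Fintype ι] (S : Schedule ι) :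
    ∫⁻ t, (S.speed t : ℝ≥0∞) = ∑ j, S.work j := by
  simp only [← lintegral_rate]
  rw [← lintegral_finsetSum _ fun j _ ↦ (S.measurable_rate j).coe_nnreal_ennreal]
  exact lintegral_congr fun t ↦ by rw [← S.sum_rate t, ENNReal.ofNNReal_finsetSum]

theorem energy_eq_sum_jobEnergy [Fintype ι] {α : ℝ} (hα : 0 < α) (S : Schedule ι) :
    S.energy α = ∑ j, S.jobEnergy α j := by
  have hm : Measurable fun t ↦ (S.speed t : ℝ≥0∞) ^ α :=
    S.measurable_speed.coe_nnreal_ennreal.pow_const α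
  simp only [jobEnergy, ← lintegral_indicator (S.measurableSet_job _)]
  rw [← lintegral_finsetSum _ fun j _ ↦ hm.indicator (S.measurableSet_job j)]
  exact lintegral_congr fun t ↦ (S.sum_indicator_job (fun t ↦ (S.speed t : ℝ≥0∞) ^ α)
    (fun t ht ↦ by simp [S.speed_idle t ht, hα]) t).symm

end Schedule

/-! ### From speed tables to schedules -/

namespace Jobs

theorem IsFeasible.isFractional {J : Jobs ι} {S : Schedule ι} (hS : J.IsFeasible S) :
    J.IsFractional S.rate where
  measurable := S.measurable_rate
  support j t hj := Set.indicator_of_notMem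
    (fun h : t ∈ {t | S.job t = some j} ↦ hj (hS.window t j h)) _
  complete j := by rw [S.lintegral_rate, hS.complete]

/-- Every speed table is realized by a schedule of the same energy, which executes the jobs
of each cell one after the other, all at the total speed of the cell. -/
theorem IsTable.exists_isFeasible [Fintype ι] {α : ℝ} (hα : 0 < α) {J : Jobs ι}
    {x : ι → Set ι → ℝ≥0} (hx : J.IsTable x) :
    ∃ S : Schedule ι, J.IsFeasible S ∧ S.energy α = J.tableEnergy α x := by
  classical
  set V : Set ι → ℝ≥0 := fun A ↦ ∑ j, x j A with hV
  have hxV : ∀ j A, V A = 0 → x j A = 0 := fun j A h ↦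
    (Finset.sum_eq_zero_iff.1 h) j (Finset.mem_univ j)
  -- Job `j` gets the fraction `x j A / V A` of the cell. If `x j A = 0` it gets the empty set and
  -- not merely a null set, because `window` is required at every time.
  have hslice : ∀ A, ∃ D : ι → Set ℝ, (∀ j, D j ⊆ J.cell A ∧ MeasurableSet (D j) ∧
      volume (D j) = ((J.cellLength A * (x j A / V A) : ℝ≥0) : ℝ≥0∞)) ∧
      Pairwise (Function.onFun Disjoint D) ∧ ∀ j, x j A = 0 → D j = ∅ := by
    intro A
    rcases eq_or_ne (J.cellLength A) 0 with h0 | h0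
    · exact ⟨fun _ ↦ ∅, by simp [h0], fun _ _ _ ↦ by simp [Function.onFun], fun _ _ ↦ rfl⟩
    have hvol : volume (J.cell A) = J.cellLength A :=
      (ENNReal.coe_toNNReal ((ENNReal.toNNReal_ne_zero).1 h0).2).symm
    obtain ⟨D, hD, hdisj⟩ := exists_pairwiseDisjoint_volume_eq Finset.univ
      (fun j ↦ ((J.cellLength A * (x j A / V A) : ℝ≥0) : ℝ≥0∞)) (J.measurableSet_cell A)
      (by simp [hvol]) (by
        rw [← ENNReal.ofNNReal_finsetSum, hvol, ENNReal.coe_le_coe, ← Finset.mul_sum,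
          ← Finset.sum_div]
        exact mul_le_of_le_one_right' (div_self_le_one _))
    have hsub : ∀ j, (if x j A = 0 then ∅ else D j) ⊆ D j := fun j ↦ by split_ifs <;> simp
    refine ⟨fun j ↦ if x j A = 0 then ∅ else D j, fun j ↦ ?_, fun j k hjk ↦
      (hdisj (by simp) (by simp) hjk).mono (hsub j) (hsub k), fun j hj ↦ if_pos hj⟩
    by_cases hj : x j A = 0
    · simp [hj]
    · simpa only [if_neg hj] using hD j (Finset.mem_univ j)
  choose D hD hdisj hempty using hslice
  have havail : ∀ {A j t}, t ∈ D A j → J.available t = A := fun h ↦ (hD _ _).1 h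
  set B : ι → Set ℝ := fun j ↦ ⋃ A, D A j with hB
  have hBmeas : ∀ j, MeasurableSet (B j) := fun j ↦ MeasurableSet.iUnion fun A ↦ (hD A j).2.1
  have hBuniq : ∀ {t j k}, t ∈ B j → t ∈ B k → j = k := by
    intro t j k hj hk
    obtain ⟨A, hA⟩ := Set.mem_iUnion.1 hj
    obtain ⟨A', hA'⟩ := Set.mem_iUnion.1 hk
    obtain rfl : A = A' := (havail hA).symm.trans (havail hA')
    by_contra hjk
    exact Set.disjoint_left.1 (hdisj A hjk) hA hA'
  set job : ℝ → Option ι := fun t ↦ if h : ∃ j, t ∈ B j then some h.choose else none with hjob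
  have hjobB : ∀ t j, job t = some j ↔ t ∈ B j := by
    intro t j
    by_cases h : ∃ j, t ∈ B j
    · simp only [hjob, h, dif_pos, Option.some.injEq]
      exact ⟨fun hj ↦ hj ▸ h.choose_spec, fun hj ↦ hBuniq h.choose_spec hj⟩
    · simp only [hjob, h, dif_neg, not_false_eq_true, reduceCtorEq, false_iff]
      exact fun hj ↦ h ⟨j, hj⟩
  have hset : ∀ j, {t | job t = some j} = B j := fun j ↦ Set.ext fun t ↦ hjobB t j
  let S : Schedule ι :=
    { speed := (⋃ j, B j).indicator fun t ↦ V (J.available t)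
      job := job
      measurable_speed := ((measurable_of_countable V).comp J.measurable_available).indicator
        (MeasurableSet.iUnion hBmeas)
      measurableSet_job := fun j ↦ hset j ▸ hBmeas j
      speed_idle := fun t ht ↦ Set.indicator_of_notMem (fun h ↦ by
        obtain ⟨j, hj⟩ := Set.mem_iUnion.1 h
        simp [(hjobB t j).2 hj] at ht) _ }
  -- Used with `φ` the identity for the work and the `α`-th power for the energy.
  have hint : ∀ (φ : ℝ≥0 → ℝ≥0∞) (j : ι), ∫⁻ t in {t | S.job t = some j}, φ (S.speed t) =
      ∑ A, φ (V A) * ((J.cellLength A * (x j A / V A) : ℝ≥0) : ℝ≥0∞) := by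
    intro φ j
    have hD' : Pairwise (Function.onFun Disjoint fun A ↦ D A j) := fun A A' h ↦
      (J.pairwise_disjoint_cell h).mono (hD A j).1 (hD A' j).1
    change ∫⁻ t in {t | job t = some j}, φ (S.speed t) = _
    rw [hset, lintegral_iUnion (fun A ↦ (hD A j).2.1) hD', tsum_fintype]
    refine Finset.sum_congr rfl fun A _ ↦ ?_
    rw [← (hD A j).2.2, ← setLIntegral_const]
    refine setLIntegral_congr_fun (hD A j).2.1 fun t ht ↦ ?_
    have hmem : t ∈ ⋃ j, B j := Set.mem_iUnion.2 ⟨j, Set.mem_iUnion.2 ⟨A, ht⟩⟩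
    simp only [S, Set.indicator_of_mem hmem, havail ht]
  refine ⟨S, ⟨fun t j hj ↦ ?_, fun j ↦ ?_⟩, ?_⟩
  · obtain ⟨A, hA⟩ := Set.mem_iUnion.1 ((hjobB t j).1 hj)
    by_contra hnot
    have hxj : x j A = 0 := hx.support j A (havail hA ▸ hnot)
    simp [hempty A j hxj] at hA
  · rw [Schedule.work, hint fun v ↦ (v : ℝ≥0∞), ENNReal.ofReal, ← hx.complete j,
      ENNReal.ofNNReal_finsetSum]
    refine Finset.sum_congr rfl fun A _ ↦ ?_
    rw [← ENNReal.coe_mul, ENNReal.coe_inj, mul_left_comm, mul_div_cancel_of_imp' (hxV j A)]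
  · rw [Schedule.energy_eq_sum_jobEnergy hα, tableEnergy, ENNReal.ofNNReal_finsetSum]
    simp only [Schedule.jobEnergy, hint fun v ↦ (v : ℝ≥0∞) ^ α]
    rw [Finset.sum_comm]
    refine Finset.sum_congr rfl fun A _ ↦ ?_
    rw [← Finset.mul_sum, ← ENNReal.ofNNReal_finsetSum, ← ENNReal.coe_rpow_of_nonneg _ hα.le,
      ← ENNReal.coe_mul, ENNReal.coe_inj, ← Finset.mul_sum, ← Finset.sum_div, mul_left_comm]
    change J.cellLength A * (V A ^ α * (V A / V A)) = J.cellLength A * V A ^ α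
    rcases eq_or_ne (V A) 0 with h0 | h0
    · simp [h0, hα.ne']
    · rw [div_self h0, mul_one]

/-! ### Existence of an optimal schedule -/

theorem isCompact_setOf_isTable [Fintype ι] (J : Jobs ι) : IsCompact {x | J.IsTable x} := by
  have hcont : ∀ (j : ι) (A : Set ι), Continuous fun x : ι → Set ι → ℝ≥0 ↦ x j A :=
    fun j A ↦ (continuous_apply A).comp (continuous_apply j)
  have hset : {x | J.IsTable x} =
      {x | ∀ j A, j ∉ A → x j A = 0} ∩ {x | ∀ j A, J.cellLength A = 0 → x j A = 0} ∩
        {x | ∀ j, ∑ A, J.cellLength A * x j A = (J.workload j).toNNReal} :=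
    Set.ext fun x ↦ ⟨fun h ↦ ⟨⟨h.support, h.null⟩, h.complete⟩, fun h ↦ ⟨h.1.1, h.1.2, h.2⟩⟩
  have hclosed : IsClosed {x | J.IsTable x} := by
    rw [hset]
    simp only [Set.ofPred_forall]
    refine ((isClosed_iInter fun j ↦ isClosed_iInter fun A ↦ isClosed_iInter fun _ ↦ ?_).inter
      (isClosed_iInter fun j ↦ isClosed_iInter fun A ↦ isClosed_iInter fun _ ↦ ?_)).inter
      (isClosed_iInter fun j ↦ ?_)
    · exact isClosed_eq (hcont j A) continuous_const
    · exact isClosed_eq (hcont j A) continuous_const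
    · exact isClosed_eq (continuous_finsetSum _ fun A _ ↦ continuous_const.mul (hcont j A))
        continuous_const
  -- A single cell cannot hold more than the whole workload. On cells of length `0` the bound is `0`
  -- by convention, in agreement with `null`.
  refine (isCompact_Icc (a := (0 : ι → Set ι → ℝ≥0))
    (b := fun j A ↦ (J.workload j).toNNReal / J.cellLength A)).of_isClosed_subset hclosed ?_
  refine fun x hx ↦ ⟨fun j A ↦ zero_le, fun j A ↦ ?_⟩
  rcases eq_or_ne (J.cellLength A) 0 with h0 | h0
  · simp [hx.null j A h0]
  · rw [le_div_iff₀' (pos_iff_ne_zero.2 h0), ← hx.complete j]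
    exact Finset.single_le_sum (f := fun A ↦ J.cellLength A * x j A) (fun _ _ ↦ zero_le)
      (Finset.mem_univ A)

/-- The fractional schedule that runs every job at constant speed while it is available. -/
theorem isFractional_const (J : Jobs ι) :
    J.IsFractional fun j ↦ (Set.Ico (J.release j) (J.deadline j)).indicator
      fun _ ↦ (J.workload j / (J.deadline j - J.release j)).toNNReal where
  measurable j := measurable_const.indicator measurableSet_Ico
  support j t hj := Set.indicator_of_notMem
    (fun h : t ∈ Set.Ico (J.release j) (J.deadline j) ↦ hj h) _
  complete j := by
    have hpos : 0 < J.deadline j - J.release j := sub_pos.2 (J.release_lt_deadline j)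
    have h : ∀ t, (((Set.Ico (J.release j) (J.deadline j)).indicator
        (fun _ ↦ (J.workload j / (J.deadline j - J.release j)).toNNReal) t : ℝ≥0) : ℝ≥0∞) =
        (Set.Ico (J.release j) (J.deadline j)).indicator
        (fun _ ↦ ENNReal.ofReal (J.workload j / (J.deadline j - J.release j))) t := fun t ↦ by
      by_cases ht : t ∈ Set.Ico (J.release j) (J.deadline j) <;>
        simp only [Set.indicator_of_mem, Set.indicator_of_notMem, ht, not_false_eq_true,
          ENNReal.coe_zero, ENNReal.ofReal]
    simp only [h]
    rw [lintegral_indicator measurableSet_Ico, setLIntegral_const, Real.volume_Ico,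
      ← ENNReal.ofReal_mul (div_nonneg (J.workload_nonneg j) hpos.le),
      div_mul_cancel₀ _ hpos.ne']

/-- A table of minimum energy is realized by a schedule; any competitor averages to a table of no
larger energy. -/
theorem exists_isOptimal [Fintype ι] {α : ℝ} (hα : 1 ≤ α) (J : Jobs ι) :
    ∃ S : Schedule ι, J.IsOptimal α S ∧ S.energy α ≠ ⊤ := by
  have hα0 : 0 < α := one_pos.trans_le hα
  obtain ⟨x₀, hx₀, -⟩ := J.isFractional_const.exists_isTable hα
  have hcont : Continuous (J.tableEnergy α) := continuous_finsetSum _ fun A _ ↦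
    continuous_const.mul ((NNReal.continuous_rpow_const hα0.le).comp
      (continuous_finsetSum _ fun j _ ↦ (continuous_apply A).comp (continuous_apply j)))
  obtain ⟨x, hx, hmin⟩ := J.isCompact_setOf_isTable.exists_isMinOn ⟨x₀, hx₀⟩ hcont.continuousOn
  obtain ⟨S, hS, hSx⟩ := IsTable.exists_isFeasible hα0 hx
  refine ⟨S, ⟨hS, fun S' hS' ↦ ?_⟩, hSx ▸ ENNReal.coe_ne_top⟩
  obtain ⟨x', hx', hle⟩ := hS'.isFractional.exists_isTable hα
  simp only [S'.sum_rate] at hle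
  rw [hSx]
  exact (ENNReal.coe_le_coe.2 (hmin hx')).trans hle

/-! ### The two bounds on the marginal share -/

theorem IsOptimal.energy_eq {α : ℝ} {J : Jobs ι} {S : Schedule ι} (hS : J.IsOptimal α S) :
    S.energy α = J.optEnergy α :=
  le_antisymm (le_iInf₂ hS.energy_le) (iInf₂_le S hS.feasible)

theorem optEnergy_ne_top [Fintype ι] {α : ℝ} (hα : 1 ≤ α) (J : Jobs ι) :
    J.optEnergy α ≠ ⊤ := by
  obtain ⟨S, hS, hfin⟩ := J.exists_isOptimal hα
  exact hS.energy_eq ▸ hfin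

/-- This lets schedules be added and averaged freely in the bounds below. -/
theorem IsFractional.optEnergy_le [Fintype ι] {α : ℝ} (hα : 1 ≤ α) {J : Jobs ι}
    {y : ι → ℝ → ℝ≥0} (hy : J.IsFractional y) :
    J.optEnergy α ≤ ∫⁻ t, ((∑ j, y j t : ℝ≥0) : ℝ≥0∞) ^ α := by
  obtain ⟨x, hx, hle⟩ := hy.exists_isTable hα
  obtain ⟨S, hS, hSx⟩ := hx.exists_isFeasible (one_pos.trans_le hα)
  exact (iInf₂_le S hS).trans (hSx ▸ hle)

/-- Leaving the machine idle whenever `S` runs job `i` serves the other jobs and saves exactly the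
energy of job `i`. -/
theorem IsFeasible.optEnergy_remove_add_jobEnergy_le [Fintype ι] {α : ℝ} (hα : 1 ≤ α)
    {J : Jobs ι} {S : Schedule ι} (hS : J.IsFeasible S) (i : ι) :
    (J.remove i).optEnergy α + S.jobEnergy α i ≤ S.energy α := by
  classical
  have hα0 : 0 < α := one_pos.trans_le hα
  have hy : (J.remove i).IsFractional fun j ↦ S.rate j :=
    ⟨fun j ↦ S.measurable_rate j, fun j t hj ↦ hS.isFractional.support j t hj,
      fun j ↦ hS.isFractional.complete j⟩
  have hm : Measurable fun t ↦ (S.speed t : ℝ≥0∞) ^ α :=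
    S.measurable_speed.coe_nnreal_ennreal.pow_const α
  refine (add_le_add_left (hy.optEnergy_le hα) _).trans_eq ?_
  rw [Schedule.jobEnergy, ← lintegral_indicator (S.measurableSet_job i),
    ← lintegral_add_right _ (hm.indicator (S.measurableSet_job i))]
  refine lintegral_congr fun t ↦ ?_
  have hsum := S.sum_rate t
  rw [Fintype.sum_eq_add_sum_subtype_ne _ i] at hsum
  by_cases h : S.job t = some i
  · have hr : S.rate i t = S.speed t := Set.indicator_of_mem (s := {t | S.job t = some i}) h _
    rw [hr] at hsum
    have h0 := left_eq_add.1 hsum.symm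
    simp [h0, h, hα0]
  · have hr : S.rate i t = 0 := Set.indicator_of_notMem (s := {t | S.job t = some i}) h _
    rw [hr, zero_add] at hsum
    rw [hsum]
    simp [h]

/-- Speeding up job `i` by a factor `1 + ε` and mixing with a schedule of the other jobs gives
a fractional schedule of all jobs. -/
theorem optEnergy_le_mix [Fintype ι] {α : ℝ} (hα : 1 ≤ α) {J : Jobs ι} {S : Schedule ι}
    (hS : J.IsFeasible S) {i : ι} {T : Schedule {j : ι // j ≠ i}}
    (hT : (J.remove i).IsFeasible T) (ε : ℝ≥0) :
    ∃ E : ℝ≥0∞, E + S.jobEnergy α i = S.energy α + (1 + ε : ℝ≥0∞) ^ α * S.jobEnergy α i ∧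
      J.optEnergy α ≤ ((1 + ε)⁻¹ : ℝ≥0) * E + (ε * (1 + ε)⁻¹ : ℝ≥0) * T.energy α := by
  classical
  have hα0 : 0 < α := one_pos.trans_le hα
  have hε : (1 + ε) ≠ 0 := by positivity
  have hw : (1 + ε)⁻¹ + ε * (1 + ε)⁻¹ = 1 := by field_simp
  -- With weights `1/(1+ε)` on `u` and `ε/(1+ε)` on `v`, job `i` receives `(1+ε) w_i / (1+ε)`, and
  -- any other job `w_j/(1+ε) + ε w_j/(1+ε)`.
  set u : ι → ℝ → ℝ≥0 := fun j t ↦ (if j = i then 1 + ε else 1) * S.rate j t with hu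
  set v : ι → ℝ → ℝ≥0 := fun j ↦ if h : j ≠ i then T.rate ⟨j, h⟩ else 0 with hv
  have hum : ∀ j, Measurable (u j) := fun j ↦ (S.measurable_rate j).const_mul _
  have hvm : ∀ j, Measurable (v j) := fun j ↦ by
    by_cases h : j ≠ i
    · simpa only [hv, dif_pos h] using T.measurable_rate _
    · simpa only [hv, dif_neg h] using measurable_zero
  have hvsum : ∀ t, ∑ j, v j t = T.speed t := fun t ↦ by
    rw [Fintype.sum_eq_add_sum_subtype_ne _ i, ← T.sum_rate t]
    have h0 : v i t = 0 := by simp [hv]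
    rw [h0, zero_add]
    refine Finset.sum_congr (by congr!) fun j _ ↦ ?_
    simp [hv, j.2]
  have hy : J.IsFractional fun j t ↦ (1 + ε)⁻¹ * u j t + ε * (1 + ε)⁻¹ * v j t := by
    refine ⟨fun j ↦ ((hum j).const_mul _).add ((hvm j).const_mul _), fun j t hj ↦ ?_,
      fun j ↦ ?_⟩
    · have h1 : u j t = 0 := by simp [hu, hS.isFractional.support j t hj]
      have h2 : v j t = 0 := by
        by_cases h : j ≠ i
        · simp only [hv, dif_pos h]
          exact hT.isFractional.support ⟨j, h⟩ t hj
        · simp [hv, not_not.1 h]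
      simp [h1, h2]
    · simp only [ENNReal.coe_add, ENNReal.coe_mul]
      rw [lintegral_add_left ((hum j).coe_nnreal_ennreal.const_mul _),
        lintegral_const_mul _ (hum j).coe_nnreal_ennreal, ← ENNReal.coe_mul,
        lintegral_const_mul _ (hvm j).coe_nnreal_ennreal]
      simp only [hu, ENNReal.coe_mul]
      rw [lintegral_const_mul _ (S.measurable_rate j).coe_nnreal_ennreal,
        hS.isFractional.complete j, ← mul_assoc, ← ENNReal.coe_mul]
      by_cases h : j = i
      · simp [hv, h]
      · have hc := hT.isFractional.complete ⟨j, h⟩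
        simp only [hv, dif_pos (show j ≠ i from h), hc, if_neg h, mul_one]
        change _ + _ * ENNReal.ofReal (J.workload j) = _
        rw [← ENNReal.coe_mul, ← add_mul, ← ENNReal.coe_add, hw, ENNReal.coe_one, one_mul]
  have hm : Measurable fun t ↦ (S.speed t : ℝ≥0∞) ^ α :=
    S.measurable_speed.coe_nnreal_ennreal.pow_const α
  have hum' : Measurable fun t ↦ ((∑ j, u j t : ℝ≥0) : ℝ≥0∞) ^ α :=
    (Finset.measurable_fun_sum _ fun j _ ↦ hum j).coe_nnreal_ennreal.pow_const α
  refine ⟨∫⁻ t, ((∑ j, u j t : ℝ≥0) : ℝ≥0∞) ^ α, ?_, ?_⟩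
  -- The energy of `u` differs from that of `S` only while job `i` runs, where it gains the factor
  -- `(1+ε)^α`. The job energy is added on the left to avoid truncated subtraction.
  · rw [Schedule.jobEnergy, ← lintegral_indicator (S.measurableSet_job i), Schedule.energy,
      ← lintegral_add_left hum', ← lintegral_const_mul _ (hm.indicator (S.measurableSet_job i)),
      ← lintegral_add_left hm]
    refine lintegral_congr fun t ↦ ?_
    have husum : ∑ j, u j t + S.rate i t = S.speed t + (1 + ε) * S.rate i t := by
      rw [← S.sum_rate t, Fintype.sum_eq_add_sum_subtype_ne _ i,
        Fintype.sum_eq_add_sum_subtype_ne (fun j ↦ S.rate j t) i]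
      have h1 : u i t = (1 + ε) * S.rate i t := by simp [hu]
      have h2 : ∑ j : {j // j ≠ i}, u j t = ∑ j : {j // j ≠ i}, S.rate j t :=
        Finset.sum_congr rfl fun j _ ↦ by simp [hu, j.2]
      rw [h1, h2]
      ring
    by_cases h : S.job t = some i
    · have hr : S.rate i t = S.speed t := Set.indicator_of_mem (s := {t | S.job t = some i}) h _
      rw [hr, add_comm (S.speed t)] at husum
      have h3 := add_right_cancel husum
      rw [h3, Set.indicator_of_mem (s := {t | S.job t = some i}) h, ENNReal.coe_mul,
        ENNReal.mul_rpow_of_nonneg _ _ hα0.le, add_comm]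
      simp
    · have hr : S.rate i t = 0 := Set.indicator_of_notMem (s := {t | S.job t = some i}) h _
      rw [hr, mul_zero, add_zero, add_zero] at husum
      rw [husum, Set.indicator_of_notMem (s := {t | S.job t = some i}) h, mul_zero]
  · refine (hy.optEnergy_le hα).trans ?_
    rw [Schedule.energy, ← lintegral_const_mul _ hum', ← lintegral_const_mul _
      (T.measurable_speed.coe_nnreal_ennreal.pow_const α), ← lintegral_add_left
      (hum'.const_mul _)]
    refine lintegral_mono fun t ↦ ?_
    rw [Finset.sum_add_distrib, ← Finset.mul_sum, ← Finset.mul_sum, hvsum]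
    simp only [← ENNReal.coe_rpow_of_nonneg _ hα0.le, ← ENNReal.coe_mul, ← ENNReal.coe_add]
    exact ENNReal.coe_le_coe.2 (NNReal.rpow_arith_mean_le_arith_mean2_rpow _ _ _ _ hw hα)

theorem IsOptimal.jobEnergy_ne_top [Fintype ι] {α : ℝ} (hα : 1 ≤ α) {J : Jobs ι}
    {S : Schedule ι} (hS : J.IsOptimal α S) (i : ι) : S.jobEnergy α i ≠ ⊤ :=
  ne_top_of_le_ne_top (hS.energy_eq.trans_ne (J.optEnergy_ne_top hα)) (setLIntegral_le_lintegral _ _)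

theorem IsOptimal.jobEnergy_le_marginalShare [Fintype ι] {α : ℝ} (hα : 1 ≤ α) {J : Jobs ι}
    {S : Schedule ι} (hS : J.IsOptimal α S) (i : ι) :
    (S.jobEnergy α i).toReal ≤ J.marginalShare α i := by
  classical
  have h := hS.feasible.optEnergy_remove_add_jobEnergy_le hα i
  rw [hS.energy_eq] at h
  have h' := ENNReal.toReal_mono (J.optEnergy_ne_top hα) h
  rw [ENNReal.toReal_add ((J.remove i).optEnergy_ne_top hα) (hS.jobEnergy_ne_top hα i)] at h'
  rw [marginalShare]
  linarith

/-- This is `optEnergy_le_mix` with an optimal `T`, multiplied by `1 + ε`. -/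
theorem IsOptimal.mul_marginalShare_le [Fintype ι] {α : ℝ} (hα : 1 ≤ α) {J : Jobs ι}
    {S : Schedule ι} (hS : J.IsOptimal α S) (i : ι) {ε : ℝ} (hε : 0 ≤ ε) :
    ε * J.marginalShare α i ≤ ((1 + ε) ^ α - 1) * (S.jobEnergy α i).toReal := by
  classical
  lift ε to ℝ≥0 using hε
  obtain ⟨T, hT, hTfin⟩ := (J.remove i).exists_isOptimal hα
  have hc := hS.jobEnergy_ne_top hα i
  have hSfin : S.energy α ≠ ⊤ := hS.energy_eq ▸ J.optEnergy_ne_top hα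
  obtain ⟨E, hE, hle⟩ := optEnergy_le_mix hα hS.feasible hT.feasible ε
  have hα0 : 0 ≤ α := zero_le_one.trans hα
  rw [← ENNReal.coe_one, ← ENNReal.coe_add, ← ENNReal.coe_rpow_of_nonneg _ hα0] at hE
  have hrhs := ENNReal.add_ne_top.2 ⟨hSfin, ENNReal.mul_ne_top
    (ENNReal.coe_ne_top (r := (1 + ε) ^ α)) hc⟩
  have hEfin : E ≠ ⊤ := ne_top_of_le_ne_top hrhs (hE ▸ le_self_add)
  have h1 := congrArg ENNReal.toReal hE
  have h2 := ENNReal.toReal_mono (ENNReal.add_ne_top.2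
    ⟨ENNReal.mul_ne_top ENNReal.coe_ne_top hEfin, ENNReal.mul_ne_top ENNReal.coe_ne_top hTfin⟩)
    hle
  rw [ENNReal.toReal_add hEfin hc, ENNReal.toReal_add hSfin (ENNReal.mul_ne_top
    ENNReal.coe_ne_top hc), ENNReal.toReal_mul, ENNReal.coe_toReal, hS.energy_eq] at h1
  rw [ENNReal.toReal_add (ENNReal.mul_ne_top ENNReal.coe_ne_top hEfin)
    (ENNReal.mul_ne_top ENNReal.coe_ne_top hTfin), ENNReal.toReal_mul, ENNReal.toReal_mul,
    ENNReal.coe_toReal, ENNReal.coe_toReal, hT.energy_eq] at h2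
  push_cast at h1 h2
  have hpos : (0 : ℝ) < 1 + ε := by positivity
  have h3 := mul_le_mul_of_nonneg_left h2 hpos.le
  rw [mul_add, mul_inv_cancel_left₀ hpos.ne', mul_comm (ε : ℝ), ← mul_assoc (1 + (ε : ℝ)),
    mul_inv_cancel_left₀ hpos.ne'] at h3
  rw [marginalShare]
  linarith

theorem IsOptimal.marginalShare_le [Fintype ι] {α : ℝ} (hα : 1 ≤ α) {J : Jobs ι}
    {S : Schedule ι} (hS : J.IsOptimal α S) (i : ι) :
    J.marginalShare α i ≤ α * (S.jobEnergy α i).toReal := by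
  have hd : HasDerivAt (fun x : ℝ ↦ x ^ α) α 1 := by
    simpa using Real.hasDerivAt_rpow_const (x := 1) (p := α) (Or.inl one_ne_zero)
  have ht := ((hd.tendsto_slope_zero_right).mul_const (S.jobEnergy α i).toReal)
  refine ge_of_tendsto ht ?_
  filter_upwards [self_mem_nhdsWithin] with ε hε
  have hε : 0 < ε := hε
  have h := hS.mul_marginalShare_le hα i hε.le
  rw [smul_eq_mul, Real.one_rpow, mul_assoc, inv_mul_eq_div, le_div_iff₀' hε]
  exact h

/-! ### Tightness of the factor `α` -/

theorem optEnergy_of_unit_window [Fintype ι] {α : ℝ} (hα : 1 ≤ α) (J : Jobs ι)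
    (hr : ∀ j, J.release j = 0) (hd : ∀ j, J.deadline j = 1) :
    J.optEnergy α = ENNReal.ofReal (∑ j, J.workload j) ^ α := by
  have hα0 : 0 < α := one_pos.trans_le hα
  apply le_antisymm
  · refine (J.isFractional_const.optEnergy_le hα).trans_eq ?_
    have h : ∀ t : ℝ, ((∑ j, (Set.Ico (J.release j) (J.deadline j)).indicator
        (fun _ ↦ (J.workload j / (J.deadline j - J.release j)).toNNReal) t : ℝ≥0) : ℝ≥0∞) ^ α =
        (Set.Ico (0 : ℝ) 1).indicator
          (fun _ ↦ ENNReal.ofReal (∑ j, J.workload j) ^ α) t := by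
      intro t
      simp only [hr, hd, sub_zero, div_one]
      by_cases ht : t ∈ Set.Ico (0 : ℝ) 1
      · simp only [Set.indicator_of_mem ht]
        rw [ENNReal.ofReal, Real.toNNReal_sum_of_nonneg fun j _ ↦ J.workload_nonneg j]
      · simp [Set.indicator_of_notMem ht, hα0]
    simp only [h]
    rw [lintegral_indicator measurableSet_Ico, setLIntegral_const]
    simp
  -- All work is done in a window of length `1`, so Jensen bounds the energy below by the `α`-th
  -- power of the total work.
  · refine le_iInf₂ fun S hS ↦ ?_
    have hsupp : ∀ t ∉ Set.Ico (0 : ℝ) 1, (S.speed t : ℝ≥0∞) = 0 := fun t ht ↦ by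
      rcases h : S.job t with _ | j
      · simp [S.speed_idle t h]
      · exact absurd (hr j ▸ hd j ▸ hS.window t j h) ht
    have hwork : ∫⁻ t in Set.Ico (0 : ℝ) 1, (S.speed t : ℝ≥0∞) =
        ENNReal.ofReal (∑ j, J.workload j) := by
      rw [setLIntegral_eq_of_support_subset (Function.support_subset_iff'.2 hsupp),
        S.lintegral_speed_eq_sum_work, ENNReal.ofReal_sum_of_nonneg fun j _ ↦ J.workload_nonneg j]
      exact Finset.sum_congr rfl fun j _ ↦ hS.complete j
    have hJ := rpow_setLIntegral_le hα (C := Set.Ico (0 : ℝ) 1) S.measurable_speed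
    rw [hwork] at hJ
    simp only [Real.volume_Ico, sub_zero, ENNReal.ofReal_one, ENNReal.one_rpow, one_mul] at hJ
    exact hJ.trans (setLIntegral_le_lintegral _ _)

end Jobs

theorem uniformJobs_optEnergy {α : ℝ} (hα : 1 ≤ α) {n : ℕ} (hn : 1 ≤ n) :
    (uniformJobs n).optEnergy α = 1 := by
  rw [Jobs.optEnergy_of_unit_window hα _ (fun _ ↦ rfl) fun _ ↦ rfl]
  have hn' : (n : ℝ) ≠ 0 := by positivity
  simp [uniformJobs, hn']

theorem uniformJobs_marginalShare {α : ℝ} (hα : 1 ≤ α) {n : ℕ} (hn : 1 ≤ n) (i : Fin n) :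
    (uniformJobs n).marginalShare α i = 1 - (1 - 1 / (n : ℝ)) ^ α := by
  have hn' : (n : ℝ) ≠ 0 := by positivity
  have hsum : ∑ j : {j : Fin n // j ≠ i}, ((uniformJobs n).remove i).workload j =
      1 - 1 / (n : ℝ) := by
    have h : ∑ j : Fin n, (uniformJobs n).workload j = 1 := by simp [uniformJobs, hn']
    rw [Fintype.sum_eq_add_sum_subtype_ne _ i] at h
    exact eq_sub_of_add_eq' h
  rw [Jobs.marginalShare, uniformJobs_optEnergy hα hn,
    Jobs.optEnergy_of_unit_window hα _ (fun _ ↦ rfl) fun _ ↦ rfl, hsum, ENNReal.toReal_one,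
    ← ENNReal.toReal_rpow, ENNReal.toReal_ofReal]
  rw [sub_nonneg, div_le_one (by positivity)]
  exact_mod_cast hn

theorem tendsto_uniformJobs_ratio {α : ℝ} (hα : 1 ≤ α) :
    Filter.Tendsto (fun n : ℕ ↦ (∑ i, (uniformJobs n).marginalShare α i) /
      ((uniformJobs n).optEnergy α).toReal) Filter.atTop (nhds α) := by
  have hd : HasDerivAt (fun x : ℝ ↦ x ^ α) α 1 := by
    simpa using Real.hasDerivAt_rpow_const (x := 1) (p := α) (Or.inl one_ne_zero)
  -- The ratio `n (1 - (1 - 1/n)^α)` is the difference quotient of `x ^ α` at `1` with increment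
  -- `-1/n`, hence the left-sided slope.
  have hlim : Filter.Tendsto (fun n : ℕ ↦ -(1 / (n : ℝ))) Filter.atTop
      (nhdsWithin 0 (Set.Iio 0)) := by
    refine tendsto_nhdsWithin_iff.2 ⟨by
      simpa using (tendsto_one_div_atTop_nhds_zero_nat (𝕜 := ℝ)).neg, ?_⟩
    filter_upwards [Filter.eventually_gt_atTop 0] with n hn
    have : (0 : ℝ) < n := by exact_mod_cast hn
    simpa using this
  refine (hd.tendsto_slope_zero_left.comp hlim).congr' ?_
  filter_upwards [Filter.eventually_ge_atTop 1] with n hn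
  simp only [uniformJobs_marginalShare hα hn, uniformJobs_optEnergy hα hn]
  simp [← sub_eq_add_neg]
  ring

end SpeedScaling

theorem theorem3 (α : ℝ) (hα : 2 ≤ α ∧ α ≤ 3) :
    (∀ (ι : Type) [Fintype ι] (J : SpeedScaling.Jobs ι),
      -- `OPT` exists and has finite energy
      (∃ S : SpeedScaling.Schedule ι, J.IsOptimal α S) ∧
      (∀ S : SpeedScaling.Schedule ι, J.IsOptimal α S →
        S.energy α = J.optEnergy α ∧ S.energy α ≠ ⊤) ∧
      -- each marginal cost share is between the proportional cost share and `α` times it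
      (∀ S : SpeedScaling.Schedule ι, J.IsOptimal α S → ∀ i : ι,
        (S.jobEnergy α i).toReal ≤ J.marginalShare α i ∧
        J.marginalShare α i ≤ α * (S.jobEnergy α i).toReal) ∧
      -- the scheme is `α`-budget-balanced
      (J.optEnergy α).toReal ≤ ∑ i, J.marginalShare α i ∧
      ∑ i, J.marginalShare α i ≤ α * (J.optEnergy α).toReal) ∧
    -- tightness of the factor `α`
    (∀ n : ℕ, 1 ≤ n →
      (SpeedScaling.uniformJobs n).optEnergy α = 1 ∧
      ∀ i, (SpeedScaling.uniformJobs n).marginalShare α i = 1 - (1 - 1 / (n : ℝ)) ^ α) ∧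
    Filter.Tendsto
      (fun n : ℕ => (∑ i, (SpeedScaling.uniformJobs n).marginalShare α i) /
        ((SpeedScaling.uniformJobs n).optEnergy α).toReal)
      Filter.atTop (nhds α) := by
  have h1 : 1 ≤ α := by linarith [hα.1]
  refine ⟨fun ι _ J ↦ ?_, fun n hn ↦ ⟨SpeedScaling.uniformJobs_optEnergy h1 hn,
    SpeedScaling.uniformJobs_marginalShare h1 hn⟩, SpeedScaling.tendsto_uniformJobs_ratio h1⟩
  obtain ⟨S, hS, hfin⟩ := J.exists_isOptimal h1
  have hsum : ∑ i, (S.jobEnergy α i).toReal = (J.optEnergy α).toReal := by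
    rw [← hS.energy_eq, S.energy_eq_sum_jobEnergy (one_pos.trans_le h1),
      ENNReal.toReal_sum fun i _ ↦ hS.jobEnergy_ne_top h1 i]
  refine ⟨⟨S, hS⟩, fun S' hS' ↦ ⟨hS'.energy_eq, hS'.energy_eq ▸ J.optEnergy_ne_top h1⟩,
    fun S' hS' i ↦ ⟨hS'.jobEnergy_le_marginalShare h1 i, hS'.marginalShare_le h1 i⟩, ?_, ?_⟩
  · rw [← hsum]
    exact Finset.sum_le_sum fun i _ ↦ hS.jobEnergy_le_marginalShare h1 i
  · rw [← hsum, Finset.mul_sum]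
    exact Finset.sum_le_sum fun i _ ↦ hS.marginalShare_le h1 i
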